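/- Let $K\subset S^3$ be a knot with complement $K^c=S^3-K$ and group $\Gamma_K=\pi_1(K^c)$. Let $\Gamma_K=\langle x_1,\dots,x_n\mid r_1,\dots,r_s\rangle$ be a finite presentation (for instance a Wirtinger presentation, with $s=n-1$), and let $t$ be a generator of $H_1(K^c)=\Gamma_K/[\Gamma_K,\Gamma_K]\cong\mathbb Z$, so that $\mathbb Z[H_1(K^c)]=\mathbb Z[t,t^{-1}]$. Let $A_K=\big(\{\partial r_i/\partial x_j\}\big)$ be the Alexander matrix of the presentation, i.e. the $s\times n$ matrix over $\mathbb Z[t,t^{-1}]$ of the images of the Fox derivatives of the relators. For $k\ge 0$ let $E_K^k\subseteq\mathbb Z[t,t^{-1}]$ be the ideal $$E_K^0=0,\qquad E_K^k=\text{ideal generated by the }(n-k)\times(n-k)\text{ minors of }A_K\ \ (0<k<n),\qquad E_K^k=\mathbb Z[t,t^{-1}]\ \ (k\ge n),$$ and let $V(E_K^k)\subseteq\mathbb C^*$ be its zero locus. Let $\mathrm{AGL}_1(\mathbb C)=\left\{\begin{pmatrix}1&0\\a&t\end{pmatrix}: a\in\mathbb C,\ t\in\mathbb C^*\right\}$ and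 let $$\pi_K:\operatorname{Hom}(\Gamma_K,\mathrm{AGL}_1(\mathbb C))\to\operatorname{Hom}(\Gamma_K,\mathbb C^*)=\mathbb C^*$$ be induced by the projection to the diagonal entry, where a character of $\Gamma_K$ is identified with its value at the chosen generator of $H_1(K^c)$. The fibre $\pi_K^{-1}(t)$ is a complex vector space by the linear structure on the off-diagonal entries: $(\rho_1+\lambda\rho_2)(\gamma)$ has off-diagonal entry $a_1+\lambda a_2$ if $\rho_i(\gamma)$ has off-diagonal entry $a_i$. 1. For every $k=0,1,\dots,n-1$ and every $t\in V(E_K^k)-V(E_K^{k+1})$, the fibre $\pi_K^{-1}(t)$ is isomorphic to $\mathbb C^{k+1}$ as a complex vector space. 2. $\emptyset=V(E_K^n)\subseteq V(E_K^{n-1})\subseteq\dots\subseteq V(E_K^1)\subseteq V(E_K^0)=\mathbb C^*$, and each $t\in\mathbb C^*$ lies in $V(E_K^k)-V(E_K^{k+1})$ for exactly one $k\in\{0,\dots,n-1\}$; thus this stratification describes the fibre dimensions of $\pi_K$. 3. For every $k\geq 0$, $V(E_K^k)$ is the zero locus in $\mathbb C^*$ of any $k$-th Alexander polynomial $\Delta_K^k$,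 i.e. of any generator of the smallest principal ideal of $\mathbb Z[t,t^{-1}]$ containing $E_K^k$. -/

import Mathlib

open scoped LaurentPolynomial

noncomputable section

namespace AlexanderFibration

/-! ### Knots and their groups -/

/-- The unit sphere `S³` of `ℝ⁴`. -/
abbrev S3 : Type := Metric.sphere (0 : EuclideanSpace ℝ (Fin 4)) 1

/-- A knot: a topological embedding of the circle into `S³`. -/
structure Knot where
  toFun : Circle → S3
  isEmbedding : Topology.IsEmbedding toFun

/-- The complement `K^c = S³ - K`. -/
def Knot.complement (K : Knot) : Set S3 := (Set.range K.toFun)ᶜ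

/-- The knot group `Γ_K = π₁(S³ - K, x)`. -/
abbrev Knot.group (K : Knot) (x : K.complement) : Type := FundamentalGroup K.complement x

/-- A finite presentation `Γ = ⟨x₁, …, xₙ | r₁, …, rₛ⟩`. -/
structure FinPresentation (Γ : Type*) [Group Γ] where
  /-- the number of generators -/
  n : ℕ
  /-- the number of relators -/
  s : ℕ
  rel : Fin s → FreeGroup (Fin n)
  iso : PresentedGroup (Set.range rel) ≃* Γ

/-- The projection `p : Fₙ → Γ`. -/
def FinPresentation.proj {Γ : Type*} [Group Γ] (P : FinPresentation Γ) :
    FreeGroup (Fin P.n) →* Γ :=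
  P.iso.toMonoidHom.comp (PresentedGroup.mk (Set.range P.rel))

/-! ### Fox calculus -/

section Fox

variable {α : Type*} [DecidableEq α]

/-- The Fox derivative of a (not necessarily reduced) word. The letter `(j, true)` stands for
`x_j` and the letter `(j, false)` for `x_j⁻¹`. -/
def foxWord (i : α) : List (α × Bool) → MonoidAlgebra ℤ (FreeGroup α)
  | [] => 0
  | (j, true) :: w =>
      (if i = j then 1 else 0) + MonoidAlgebra.of ℤ _ (FreeGroup.of j) * foxWord i w
  | (j, false) :: w =>
      MonoidAlgebra.of ℤ _ (FreeGroup.of j)⁻¹ * (foxWord i w - (if i = j then 1 else 0))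

theorem foxWord_append (i : α) (L M : List (α × Bool)) :
    foxWord i (L ++ M) =
      foxWord i L + MonoidAlgebra.of ℤ _ (FreeGroup.mk L) * foxWord i M := by
  induction L with
  | nil =>
    have h : (FreeGroup.mk ([] : List (α × Bool))) = 1 := rfl
    rw [h, map_one]
    simp [foxWord]
  | cons a L ih =>
    obtain ⟨j, b⟩ := a
    cases b
    · have h : FreeGroup.mk ((j, false) :: L) = (FreeGroup.of j)⁻¹ * FreeGroup.mk L := rfl
      simp only [List.cons_append, foxWord, ih, h, map_mul]
      noncomm_ring
    · have h : FreeGroup.mk ((j, true) :: L) = FreeGroup.of j * FreeGroup.mk L := rfl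
      simp only [List.cons_append, foxWord, ih, h, map_mul]
      noncomm_ring

theorem foxWord_step (i : α) {L M : List (α × Bool)} (h : FreeGroup.Red.Step L M) :
    foxWord i L = foxWord i M := by
  obtain @⟨L₁, L₂, j, b⟩ := h
  have key : foxWord i ((j, b) :: (j, !b) :: L₂) = foxWord i L₂ := by
    cases b
    · simp only [Bool.not_false, foxWord, add_sub_cancel_left, ← mul_assoc, ← map_mul,
        inv_mul_cancel, map_one, one_mul]
    · simp only [Bool.not_true, foxWord, ← mul_assoc, ← map_mul,
        mul_inv_cancel, map_one, one_mul, add_sub_cancel]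
  rw [foxWord_append, foxWord_append, key]

/-- The Fox derivative `∂w/∂x_i ∈ ℤ[F]` of an element `w` of the free group `F`. -/
def foxDeriv (i : α) : FreeGroup α → MonoidAlgebra ℤ (FreeGroup α) :=
  Quot.lift (foxWord i) fun _ _ h => foxWord_step i h

theorem foxDeriv_one (i : α) : foxDeriv i (1 : FreeGroup α) = 0 := rfl

theorem foxDeriv_of (i j : α) : foxDeriv i (FreeGroup.of j) = if i = j then 1 else 0 := by
  change foxWord i [(j, true)] = _
  simp [foxWord]

theorem foxDeriv_mul (i : α) (v w : FreeGroup α) :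
    foxDeriv i (v * w) = foxDeriv i v + MonoidAlgebra.of ℤ _ v * foxDeriv i w := by
  induction v using Quot.inductionOn with
  | h L =>
    induction w using Quot.inductionOn with
    | h M => exact foxWord_append i L M

end Fox

/-! ### The Alexander matrix, its elementary ideals and the Alexander polynomials

Throughout, `h` is an identification of the abelianization of `Γ` (for a knot group, of
`H₁(K^c)`) with the infinite cyclic group, i.e. a choice of a generator `t`. -/

section Alexander

variable {Γ : Type*} [Group Γ] (h : Abelianization Γ ≃* Multiplicative ℤ) (P : FinPresentation Γ)

/-- The exponent `m` such that the class of `g` in the abelianization is `t ^ m`. -/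
def degree (g : Γ) : ℤ := Multiplicative.toAdd (h (Abelianization.of g))

theorem degree_mul (g g' : Γ) : degree h (g * g') = degree h g + degree h g' := by
  simp [degree]

theorem degree_one : degree h 1 = 0 := by simp [degree]

/-- The ring homomorphism `ℤ[Fₙ] → ℤ[Γ] → ℤ[Γ^ab] = ℤ[t, t⁻¹]`, sending `w` to `{w}`. -/
def abRingHom : MonoidAlgebra ℤ (FreeGroup (Fin P.n)) →ₐ[ℤ] ℤ[T;T⁻¹] :=
  MonoidAlgebra.lift ℤ _ _
    { toFun := fun w => LaurentPolynomial.T (degree h (P.proj w))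
      map_one' := by simp [degree_one]
      map_mul' := fun v w => by rw [map_mul, degree_mul, LaurentPolynomial.T_add] }

/-- The Alexander matrix `({∂r_i/∂x_j})`. -/
def alexanderMatrix : Matrix (Fin P.s) (Fin P.n) ℤ[T;T⁻¹] :=
  Matrix.of fun i j => abRingHom h P (foxDeriv j (P.rel i))

/-- The `k`-th elementary ideal: `0` for `k = 0`, generated by the `(n-k) × (n-k)` minors of the
Alexander matrix for `0 < k < n`, and the unit ideal for `k ≥ n`. -/
def elementaryIdeal (k : ℕ) : Ideal ℤ[T;T⁻¹] :=
  if k = 0 then ⊥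
  else if k < P.n then
    Ideal.span {d | ∃ (f : Fin (P.n - k) ↪o Fin P.s) (g : Fin (P.n - k) ↪o Fin P.n),
      d = ((alexanderMatrix h P).submatrix f g).det}
  else ⊤

/-- The value of a Laurent polynomial with integer coefficients at `t ∈ ℂ^*`. -/
def evalAt (t : ℂˣ) : ℤ[T;T⁻¹] →+* ℂ := LaurentPolynomial.eval₂ (Int.castRingHom ℂ) t

/-- The zero locus `V(E) ⊆ ℂ^*` of an ideal `E ⊆ ℤ[t, t⁻¹]`. -/
def zeroLocus (E : Ideal ℤ[T;T⁻¹]) : Set ℂˣ := {t | ∀ f ∈ E, evalAt t f = 0}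

/-- `Δ` is a `k`-th Alexander polynomial: a generator of the smallest principal ideal containing
the `k`-th elementary ideal. -/
def IsAlexanderPolynomial (k : ℕ) (Δ : ℤ[T;T⁻¹]) : Prop :=
  elementaryIdeal h P k ≤ Ideal.span {Δ} ∧
    ∀ q : ℤ[T;T⁻¹], elementaryIdeal h P k ≤ Ideal.span {q} →
      Ideal.span {Δ} ≤ Ideal.span {q}

end Alexander

/-! ### The group of affine transformations of the complex line -/

/-- `AGL₁(ℂ)`: the pair `(a, t)` is the matrix `!![1, 0; a, t]`. -/
@[ext]
structure AGL1 where
  a : ℂ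
  t : ℂˣ

namespace AGL1

instance : Mul AGL1 := ⟨fun A B => ⟨A.a + A.t * B.a, A.t * B.t⟩⟩

instance : One AGL1 := ⟨⟨0, 1⟩⟩

instance : Inv AGL1 := ⟨fun A => ⟨-((A.t⁻¹ : ℂˣ) * A.a), A.t⁻¹⟩⟩

@[simp] theorem mul_a (A B : AGL1) : (A * B).a = A.a + A.t * B.a := rfl
@[simp] theorem mul_t (A B : AGL1) : (A * B).t = A.t * B.t := rfl
@[simp] theorem one_a : (1 : AGL1).a = 0 := rfl
@[simp] theorem one_t : (1 : AGL1).t = 1 := rfl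
@[simp] theorem inv_a (A : AGL1) : A⁻¹.a = -((A.t⁻¹ : ℂˣ) * A.a) := rfl
@[simp] theorem inv_t (A : AGL1) : A⁻¹.t = A.t⁻¹ := rfl

instance : Group AGL1 :=
  Group.ofLeftAxioms
    (fun A B C => by
      ext
      · simp only [mul_a, mul_t, Units.val_mul]; ring
      · simp [mul_assoc])
    (fun A => by ext <;> simp)
    (fun A => by ext <;> simp)

/-- The matrix of an element of `AGL₁(ℂ)`. -/
def toMatrix (A : AGL1) : Matrix (Fin 2) (Fin 2) ℂ := !![1, 0; A.a, A.t]

theorem toMatrix_mul (A B : AGL1) : (A * B).toMatrix = A.toMatrix * B.toMatrix := by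
  simp [toMatrix]

/-- The projection `AGL₁(ℂ) → ℂ^*` onto the diagonal entry. -/
def diag : AGL1 →* ℂˣ where
  toFun := AGL1.t
  map_one' := rfl
  map_mul' _ _ := rfl

end AGL1

/-! ### The Alexander fibration -/

section Fibration

variable {Γ : Type*} [Group Γ] (h : Abelianization Γ ≃* Multiplicative ℤ)

/-- The identification `Hom(Γ, ℂ^*) = Hom(Γ^ab, ℂ^*) = ℂ^*`, by the value at the generator of
`Γ^ab` given by `h`. -/
def characterEquiv : (Γ →* ℂˣ) ≃ ℂˣ :=
  (Abelianization.lift.trans h.monoidHomCongrLeftEquiv).trans (zpowersHom ℂˣ).symm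

theorem characterEquiv_symm_apply (t : ℂˣ) (g : Γ) :
    (characterEquiv h).symm t g = t ^ degree h g := by
  simp [characterEquiv, degree]

/-- The Alexander fibration `π : Hom(Γ, AGL₁(ℂ)) → Hom(Γ, ℂ^*) = ℂ^*`. -/
def alexanderFibration (ρ : Γ →* AGL1) : ℂˣ := characterEquiv h (AGL1.diag.comp ρ)

/-- The fibre `π⁻¹(t)`. -/
def Fibre (t : ℂˣ) : Type _ := {ρ : Γ →* AGL1 // alexanderFibration h ρ = t}

theorem alexanderFibration_eq_iff (ρ : Γ →* AGL1) (t : ℂˣ) :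
    alexanderFibration h ρ = t ↔ ∀ g, (ρ g).t = t ^ degree h g := by
  rw [alexanderFibration, ← Equiv.eq_symm_apply, MonoidHom.ext_iff]
  simp only [characterEquiv_symm_apply]
  rfl

namespace Fibre

variable {h} {t : ℂˣ}

/-- The off-diagonal entries of the representation `ρ`. -/
def offDiag (ρ : Fibre h t) : Γ → ℂ := fun g => (ρ.1 g).a

theorem offDiag_mul (ρ : Fibre h t) (g g' : Γ) :
    ρ.offDiag (g * g') = ρ.offDiag g + (t ^ degree h g : ℂˣ) * ρ.offDiag g' := by
  simp [offDiag, (alexanderFibration_eq_iff h ρ.1 t).1 ρ.2]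

theorem offDiag_injective : Function.Injective (offDiag : Fibre h t → Γ → ℂ) := by
  intro ρ σ e
  apply Subtype.ext
  ext g : 1
  apply AGL1.ext
  · exact congrFun e g
  · rw [(alexanderFibration_eq_iff h _ t).1 ρ.2, (alexanderFibration_eq_iff h _ t).1 σ.2]

/-- The representation in the fibre over `t` with given off-diagonal entries. -/
def mk (c : Γ → ℂ) (hc : ∀ g g', c (g * g') = c g + (t ^ degree h g : ℂˣ) * c g') :
    Fibre h t :=
  ⟨MonoidHom.mk' (fun g => ⟨c g, t ^ degree h g⟩) fun g g' => by
      ext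
      · exact hc g g'
      · simp [degree_mul, zpow_add],
    (alexanderFibration_eq_iff h _ t).2 fun _ => rfl⟩

/-! The vector space structure: `(ρ + λσ)(g) = (a + λb, t)` if `ρ(g) = (a, t)` and
`σ(g) = (b, t)`. -/

instance : Zero (Fibre h t) := ⟨mk 0 (by simp)⟩

instance : Add (Fibre h t) :=
  ⟨fun ρ σ => mk (ρ.offDiag + σ.offDiag) fun g g' => by
    simp only [Pi.add_apply, offDiag_mul]; ring⟩

instance : Neg (Fibre h t) :=
  ⟨fun ρ => mk (-ρ.offDiag) fun g g' => by
    simp only [Pi.neg_apply, offDiag_mul]; ring⟩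

instance : SMul ℂ (Fibre h t) :=
  ⟨fun c ρ => mk (c • ρ.offDiag) fun g g' => by
    simp only [Pi.smul_apply, smul_eq_mul, offDiag_mul]; ring⟩

theorem offDiag_zero : (0 : Fibre h t).offDiag = 0 := rfl
theorem offDiag_add (ρ σ : Fibre h t) : (ρ + σ).offDiag = ρ.offDiag + σ.offDiag := rfl
theorem offDiag_neg (ρ : Fibre h t) : (-ρ).offDiag = -ρ.offDiag := rfl
theorem offDiag_smul (c : ℂ) (ρ : Fibre h t) : (c • ρ).offDiag = c • ρ.offDiag := rfl

instance : AddCommGroup (Fibre h t) where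
  add_assoc ρ σ τ := offDiag_injective (by simp only [offDiag_add, add_assoc])
  zero_add ρ := offDiag_injective (by simp only [offDiag_add, offDiag_zero, zero_add])
  add_zero ρ := offDiag_injective (by simp only [offDiag_add, offDiag_zero, add_zero])
  nsmul := nsmulRec
  zsmul := zsmulRec
  neg_add_cancel ρ := offDiag_injective (by
    simp only [offDiag_add, offDiag_neg, offDiag_zero, neg_add_cancel])
  add_comm ρ σ := offDiag_injective (by simp only [offDiag_add, add_comm])

instance : Module ℂ (Fibre h t) where
  one_smul ρ := offDiag_injective (by simp only [offDiag_smul, one_smul])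
  mul_smul c d ρ := offDiag_injective (by simp only [offDiag_smul, mul_smul])
  smul_zero c := offDiag_injective (by simp only [offDiag_smul, offDiag_zero, smul_zero])
  smul_add c ρ σ := offDiag_injective (by simp only [offDiag_smul, offDiag_add, smul_add])
  add_smul c d ρ := offDiag_injective (by simp only [offDiag_smul, offDiag_add, add_smul])
  zero_smul ρ := offDiag_injective (by simp only [offDiag_smul, offDiag_zero, zero_smul])

end Fibre

end Fibration

end AlexanderFibration

end

/-! A point of the fibre over `t` is a crossed homomorphism `c (g * g') = c g + t ^ degree g * c
g'`. On the free group it is determined by arbitrary values `v` on the generators, with the Fox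
derivatives as coefficients, and it descends to `Γ` exactly when it kills the relators, i.e. when
`A(t) v = 0` for the Alexander matrix evaluated at `t`. So the fibre is `ker A(t)`, of dimension `n
- rank A(t)` (`range_generatorEntries`, `rank_add_finrank_fibre`).

Rank is detected by minors, so `t ∈ V(E^k)` iff `rank A(t) + k < n`
(`mem_zeroLocus_elementaryIdeal_iff`). The convention `E^0 = 0` fits because the fibre is never
zero. The first two claims are then arithmetic in the rank.

For Alexander polynomials, the Laurent polynomials vanishing at `t` form a principal ideal, so it
contains `E^k` iff it contains the smallest principal ideal over `E^k`. -/

namespace AlexanderFibration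

/-! ### Vanishing ideals of points are principal -/

open Polynomial in
/-- The integer polynomials vanishing at a complex number form a principal ideal. -/
theorem exists_ker_eval₂_int_dvd (z : ℂ) :
    ∃ q : ℤ[X], q.eval₂ (Int.castRingHom ℂ) z = 0 ∧
      ∀ p : ℤ[X], p.eval₂ (Int.castRingHom ℂ) z = 0 → q ∣ p := by
  have haeval : ∀ p : ℤ[X], p.eval₂ (Int.castRingHom ℂ) z =
      aeval z (p.map (Int.castRingHom ℚ)) := fun p => by
    rw [aeval_def, eval₂_map]
    congr 1
  by_cases hz : IsIntegral ℚ z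
  -- Algebraic case: clear denominators in the minimal polynomial and take the primitive part.
  -- Gauss's lemma turns divisibility over `ℚ` into divisibility over `ℤ`.
  · have hm := minpoly.ne_zero hz
    obtain ⟨b, hb, hspec⟩ := IsLocalization.integerNormalization_spec
      (nonZeroDivisors ℤ) (minpoly ℚ z)
    set N := IsLocalization.integerNormalization (nonZeroDivisors ℤ) (minpoly ℚ z)
    have hb0 : (b : ℚ) ≠ 0 := by exact_mod_cast nonZeroDivisors.ne_zero hb
    have hNmap : N.map (Int.castRingHom ℚ) = C (b : ℚ) * minpoly ℚ z := by
      rw [← smul_eq_C_mul, Int.cast_smul_eq_zsmul]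
      exact hspec
    have hN0 : N ≠ 0 := by
      intro h0
      rw [h0, Polynomial.map_zero, eq_comm, mul_eq_zero] at hNmap
      exact hNmap.elim (fun h => hb0 (C_eq_zero.1 h)) hm
    have hc0 : (N.content : ℚ) ≠ 0 := by
      exact_mod_cast fun h => hN0 (content_eq_zero_iff.1 h)
    have hmap : C (N.content : ℚ) * N.primPart.map (Int.castRingHom ℚ) =
        C (b : ℚ) * minpoly ℚ z := by
      rw [← hNmap]
      conv_rhs => rw [N.eq_C_content_mul_primPart]
      simp
    refine ⟨N.primPart, ?_, fun p hp => ?_⟩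
    · rw [haeval]
      have := congrArg (aeval z) hmap
      rw [map_mul, map_mul, minpoly.aeval, mul_zero, aeval_C, mul_eq_zero] at this
      refine this.resolve_left ?_
      simpa using hc0
    · rw [IsPrimitive.Int.dvd_iff_map_cast_dvd_map_cast _ _ N.isPrimitive_primPart]
      · rw [haeval] at hp
        have h1 := minpoly.dvd ℚ z hp
        refine dvd_trans ?_ h1
        have hu : IsUnit (C (b : ℚ)) := isUnit_C.2 hb0.isUnit
        rw [← hu.dvd_mul_left, ← hmap]
        exact Dvd.intro_left _ rfl
  -- Transcendental case: only the zero polynomial vanishes at `z`.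
  · refine ⟨0, by simp, fun p hp => ?_⟩
    rw [haeval] at hp
    by_contra h0
    refine hz (IsAlgebraic.isIntegral ⟨_, ?_, hp⟩)
    rw [Ne, Polynomial.map_eq_zero_iff (RingHom.injective_int _)]
    rintro rfl
    exact h0 dvd_rfl

/-- The integral Laurent polynomials vanishing at `t` form a principal ideal. -/
theorem exists_ker_evalAt_eq_span (t : ℂˣ) :
    ∃ q : ℤ[T;T⁻¹], RingHom.ker (evalAt t) = Ideal.span {q} := by
  obtain ⟨q, hq, hdvd⟩ := exists_ker_eval₂_int_dvd (t : ℂ)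
  refine ⟨Polynomial.toLaurent q, le_antisymm (fun f hf => ?_) ?_⟩
  -- Powers of `T` are units, so `f` may be replaced by an ordinary polynomial.
  · obtain ⟨n, p, hp⟩ := f.exists_T_pow
    have hunit : f = Polynomial.toLaurent p * LaurentPolynomial.T (-n) := by
      rw [hp, mul_assoc, ← LaurentPolynomial.T_add]
      simp
    have : q ∣ p := hdvd p (by
      rw [← LaurentPolynomial.eval₂_toLaurent, hp, map_mul]
      exact mul_eq_zero_of_left hf _)
    rw [Ideal.mem_span_singleton, hunit]
    exact Dvd.dvd.mul_right (map_dvd _ this) _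
  · rw [Ideal.span_singleton_le_iff_mem, RingHom.mem_ker, evalAt,
      LaurentPolynomial.eval₂_toLaurent, hq]

theorem mem_zeroLocus_iff_le_ker {t : ℂˣ} {E : Ideal ℤ[T;T⁻¹]} :
    t ∈ zeroLocus E ↔ E ≤ RingHom.ker (evalAt t) := Iff.rfl

theorem mem_zeroLocus_span_iff {t : ℂˣ} {S : Set ℤ[T;T⁻¹]} :
    t ∈ zeroLocus (Ideal.span S) ↔ ∀ f ∈ S, evalAt t f = 0 := by
  rw [mem_zeroLocus_iff_le_ker, Ideal.span_le]
  rfl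

/-! ### Rank and minors -/

section Minors

variable {F : Type*} [Field F]

/-- Any `m` indices of a basis of the span chosen from the family will do; listing them increasingly
gives the order embedding. -/
theorem exists_orderEmb_linearIndependent {V : Type*} [AddCommGroup V] [Module F V] {n m : ℕ}
    (v : Fin n → V) (hm : m ≤ Module.finrank F (Submodule.span F (Set.range v))) :
    ∃ g : Fin m ↪o Fin n, LinearIndependent F (v ∘ g) := by
  obtain ⟨κ, a, ha, hspan, hli⟩ := exists_linearIndependent' F v
  have : Fintype κ := Fintype.ofInjective a ha
  rw [← hspan, finrank_span_eq_card hli] at hm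
  obtain ⟨u, hus, hu⟩ := Finset.exists_subset_card_eq
    (s := Finset.univ.map ⟨a, ha⟩) (n := m) (by simpa using hm)
  have hex : ∀ i, ∃ k, a k = u.orderEmbOfFin hu i := fun i => by
    simpa using hus (u.orderEmbOfFin_mem hu i)
  choose c hc using hex
  refine ⟨u.orderEmbOfFin hu, ?_⟩
  have hcomp : v ∘ u.orderEmbOfFin hu = (v ∘ a) ∘ c := by
    ext i
    simp [hc]
  rw [hcomp]
  refine hli.comp c fun i j hij => (u.orderEmbOfFin hu).injective ?_
  rw [← hc, ← hc, hij]

/-- A matrix over a field has rank at least `m` iff it has a nonzero `m × m` minor. -/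
theorem le_rank_iff_exists_minor {s n : ℕ} (M : Matrix (Fin s) (Fin n) F) (m : ℕ) :
    m ≤ M.rank ↔
      ∃ (f : Fin m ↪o Fin s) (g : Fin m ↪o Fin n), (M.submatrix f g).det ≠ 0 := by
  constructor
  · intro hm
    rw [Matrix.rank_eq_finrank_span_cols] at hm
    -- Select `m` independent columns, then `m` independent rows of the resulting submatrix.
    obtain ⟨g, hg⟩ := exists_orderEmb_linearIndependent _ hm
    have hr : m = (M.submatrix id g).rank := by
      rw [← Matrix.rank_transpose, LinearIndependent.rank_matrix (by exact hg), Fintype.card_fin]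
    obtain ⟨f, hf⟩ := exists_orderEmb_linearIndependent (F := F) (M.submatrix id g).row
      (m := m) (by rw [← Matrix.rank_eq_finrank_span_row]; exact hr.le)
    refine ⟨f, g, ?_⟩
    have : LinearIndependent F (M.submatrix f g).row := hf
    exact ((Matrix.isUnit_iff_isUnit_det _).1
      (Matrix.linearIndependent_rows_iff_isUnit.1 this)).ne_zero
  · rintro ⟨f, g, hd⟩
    have := Matrix.rank_of_det_ne_zero hd
    rw [Fintype.card_fin] at this
    exact this.symm.le.trans (M.rank_submatrix_le f g)

end Minors

/-! ### Fibres as kernels of the evaluated Alexander matrix -/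

section Fibration

variable {Γ : Type*} [Group Γ] (h : Abelianization Γ ≃* Multiplicative ℤ) (P : FinPresentation Γ)

/-- The Alexander matrix evaluated at `t`. -/
noncomputable def alexanderMatrixAt (t : ℂˣ) : Matrix (Fin P.s) (Fin P.n) ℂ :=
  (alexanderMatrix h P).map (evalAt t)

theorem evalAt_abRingHom_of (t : ℂˣ) (w : FreeGroup (Fin P.n)) :
    evalAt t (abRingHom h P (MonoidAlgebra.of ℤ _ w)) =
      ((t ^ degree h (P.proj w) : ℂˣ) : ℂ) := by
  simp [abRingHom, evalAt]

/-- The representation of the free group over `t` with prescribed off-diagonal entries at the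
generators, given by Fox calculus. -/
noncomputable def foxHom (t : ℂˣ) (v : Fin P.n → ℂ) : FreeGroup (Fin P.n) →* AGL1 :=
  MonoidHom.mk' (fun w => ⟨∑ j, evalAt t (abRingHom h P (foxDeriv j w)) * v j,
    t ^ degree h (P.proj w)⟩) fun w w' => by
      ext
      · simp only [foxDeriv_mul, map_add, map_mul, evalAt_abRingHom_of, add_mul,
          Finset.sum_add_distrib, AGL1.mul_a, Finset.mul_sum, mul_assoc]
      · simp [degree_mul, zpow_add]

theorem foxHom_a (t : ℂˣ) (v : Fin P.n → ℂ) (w : FreeGroup (Fin P.n)) :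
    (foxHom h P t v w).a = ∑ j, evalAt t (abRingHom h P (foxDeriv j w)) * v j := rfl

theorem foxHom_t (t : ℂˣ) (v : Fin P.n → ℂ) (w : FreeGroup (Fin P.n)) :
    (foxHom h P t v w).t = t ^ degree h (P.proj w) := rfl

theorem foxHom_of_a (t : ℂˣ) (v : Fin P.n → ℂ) (j : Fin P.n) :
    (foxHom h P t v (FreeGroup.of j)).a = v j := by
  simp [foxHom_a, foxDeriv_of, apply_ite]

theorem proj_rel (i : Fin P.s) : P.proj (P.rel i) = 1 := by
  have : PresentedGroup.mk (Set.range P.rel) (P.rel i) = 1 :=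
    PresentedGroup.one_of_mem (Set.mem_range_self i)
  simp [FinPresentation.proj, this]

/-- Relators have degree zero, so the only obstruction to descending to `Γ` is the vector `A(t) v`.
-/
theorem foxHom_rel (t : ℂˣ) (v : Fin P.n → ℂ) (i : Fin P.s) :
    foxHom h P t v (P.rel i) = ⟨(alexanderMatrixAt h P t).mulVec v i, 1⟩ := by
  ext
  · rfl
  · rw [foxHom_t, proj_rel, degree_one, zpow_zero]

theorem proj_surjective : Function.Surjective P.proj :=
  P.iso.surjective.comp (PresentedGroup.mk_surjective _)

variable {h} {t : ℂˣ}

theorem Fibre.comp_proj (ρ : Fibre h t) :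
    ρ.1.comp P.proj = foxHom h P t fun j => ρ.offDiag (P.proj (FreeGroup.of j)) := by
  ext j : 1
  refine AGL1.ext ?_ ?_
  · rw [foxHom_of_a]
    rfl
  · exact (alexanderFibration_eq_iff h _ t).1 ρ.2 _

variable (h t)

/-- The off-diagonal entries at the generators of a presentation. -/
noncomputable def generatorEntries : Fibre h t →ₗ[ℂ] (Fin P.n → ℂ) where
  toFun ρ j := ρ.offDiag (P.proj (FreeGroup.of j))
  map_add' _ _ := rfl
  map_smul' _ _ := rfl

theorem generatorEntries_injective : Function.Injective (generatorEntries h P t) := by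
  intro ρ σ e
  apply Subtype.ext
  have : ρ.1.comp P.proj = σ.1.comp P.proj := by
    rw [Fibre.comp_proj, Fibre.comp_proj]
    exact congrArg _ e
  exact (MonoidHom.cancel_right (proj_surjective P)).1 this

/-- The equations `A(t) v = 0` say that `foxHom` kills every relator, which is the condition for it
to factor through the presented group. -/
theorem range_generatorEntries :
    LinearMap.range (generatorEntries h P t) =
      LinearMap.ker (alexanderMatrixAt h P t).mulVecLin := by
  ext v
  rw [LinearMap.mem_range, LinearMap.mem_ker, Matrix.mulVecLin_apply]
  constructor
  · rintro ⟨ρ, rfl⟩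
    ext i
    have h1 := DFunLike.congr_fun (Fibre.comp_proj P ρ) (P.rel i)
    rw [MonoidHom.comp_apply, proj_rel, map_one, foxHom_rel] at h1
    exact (congrArg AGL1.a h1).symm
  · intro hv
    have hlift : FreeGroup.lift (fun j => foxHom h P t v (FreeGroup.of j)) = foxHom h P t v := by
      ext j : 1
      simp
    have hrel : ∀ r ∈ Set.range P.rel,
        FreeGroup.lift (fun j => foxHom h P t v (FreeGroup.of j)) r = 1 := by
      rintro _ ⟨i, rfl⟩
      rw [hlift, foxHom_rel, hv]
      rfl
    let ρ : Γ →* AGL1 := (PresentedGroup.toGroup hrel).comp P.iso.symm.toMonoidHom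
    have hρ : ∀ w, ρ (P.proj w) = foxHom h P t v w := fun w => by
      rw [← hlift]
      simp only [ρ, FinPresentation.proj, MonoidHom.comp_apply, MulEquiv.toMonoidHom_eq_coe,
        MonoidHom.coe_coe, MulEquiv.symm_apply_apply]
      rfl
    refine ⟨⟨ρ, (alexanderFibration_eq_iff h _ t).2 fun g => ?_⟩, funext fun j => ?_⟩
    · obtain ⟨w, rfl⟩ := proj_surjective P g
      rw [hρ, foxHom_t]
    · exact (congrArg AGL1.a (hρ _)).trans (foxHom_of_a h P t v j)

theorem rank_add_finrank_fibre :
    (alexanderMatrixAt h P t).rank + Module.finrank ℂ (Fibre h t) = P.n := by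
  rw [← LinearMap.finrank_range_of_inj (generatorEntries_injective h P t),
    range_generatorEntries, Matrix.rank, LinearMap.finrank_range_add_finrank_ker,
    Module.finrank_fin_fun]

theorem finite_fibre (P : FinPresentation Γ) : Module.Finite ℂ (Fibre h t) :=
  Module.Finite.of_injective _ (generatorEntries_injective h P t)

theorem degree_surjective : Function.Surjective (degree h) :=
  Multiplicative.toAdd.surjective.comp (h.surjective.comp QuotientGroup.mk_surjective)

/-- An explicit crossed homomorphism is nonzero at an element of degree 1: the degree itself if `t =
1`, and the coboundary `t ^ degree g - 1` otherwise. -/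
theorem nontrivial_fibre : Nontrivial (Fibre h t) := by
  obtain ⟨g, hg⟩ := degree_surjective h 1
  suffices ∃ ρ : Fibre h t, ρ.offDiag g ≠ 0 by
    obtain ⟨ρ, hρ⟩ := this
    exact nontrivial_of_ne ρ 0 fun h0 => hρ (by rw [h0]; rfl)
  by_cases ht : t = 1
  · exact ⟨Fibre.mk (fun g => (degree h g : ℂ)) (by simp [ht, degree_mul]),
      (by simp [hg] : (degree h g : ℂ) ≠ 0)⟩
  · refine ⟨Fibre.mk (fun g => ((t ^ degree h g : ℂˣ) : ℂ) - 1) fun g g' => ?_, ?_⟩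
    · rw [degree_mul, zpow_add, Units.val_mul]
      ring
    · change ((t ^ degree h g : ℂˣ) : ℂ) - 1 ≠ 0
      rw [hg, zpow_one, sub_ne_zero]
      exact fun h1 => ht (Units.ext h1)

theorem rank_alexanderMatrixAt_lt : (alexanderMatrixAt h P t).rank < P.n := by
  -- Finiteness rules out the default value `finrank = 0` of an infinite-dimensional space.
  have := finite_fibre h t P
  have := nontrivial_fibre h t
  have h1 : 0 < Module.finrank ℂ (Fibre h t) := Module.finrank_pos
  have h2 := rank_add_finrank_fibre h P t
  omega

/-- For `0 < k < n` all minors of size `n - k` vanish at `t` iff the rank is below `n - k`. At `k =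
0` both sides always hold, by `rank_alexanderMatrixAt_lt`; for `k ≥ n` neither does. -/
theorem mem_zeroLocus_elementaryIdeal_iff (k : ℕ) :
    t ∈ zeroLocus (elementaryIdeal h P k) ↔ (alexanderMatrixAt h P t).rank + k < P.n := by
  have hlt := rank_alexanderMatrixAt_lt h P t
  rw [elementaryIdeal]
  split_ifs with h0 hk
  · rw [h0, add_zero, mem_zeroLocus_iff_le_ker]
    simp [hlt]
  · rw [mem_zeroLocus_span_iff, ← Nat.lt_sub_iff_add_lt, ← not_le, le_rank_iff_exists_minor]
    have hdet : ∀ (f : Fin (P.n - k) ↪o Fin P.s) (g : Fin (P.n - k) ↪o Fin P.n),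
        ((alexanderMatrixAt h P t).submatrix f g).det =
          evalAt t ((alexanderMatrix h P).submatrix f g).det := fun f g => by
      rw [RingHom.map_det, RingHom.mapMatrix_apply, alexanderMatrixAt, Matrix.submatrix_map]
    simp only [hdet, not_exists, not_not]
    exact ⟨fun H f g => H _ ⟨f, g, rfl⟩, fun H _ ⟨f, g, e⟩ => e ▸ H f g⟩
  · refine iff_of_false (fun H => ?_) (by omega)
    simpa using H 1 trivial

theorem mem_stratum_iff (k : ℕ) :
    t ∈ zeroLocus (elementaryIdeal h P k) \ zeroLocus (elementaryIdeal h P (k + 1)) ↔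
      (alexanderMatrixAt h P t).rank + (k + 1) = P.n := by
  rw [Set.mem_sdiff, mem_zeroLocus_elementaryIdeal_iff, mem_zeroLocus_elementaryIdeal_iff]
  omega

theorem zeroLocus_elementaryIdeal_eq {k : ℕ} {Δ : ℤ[T;T⁻¹]}
    (hΔ : IsAlexanderPolynomial h P k Δ) :
    zeroLocus (elementaryIdeal h P k) = {t : ℂˣ | evalAt t Δ = 0} := by
  ext t
  obtain ⟨q, hq⟩ := exists_ker_evalAt_eq_span t
  rw [Set.mem_ofPred_eq, ← RingHom.mem_ker, ← Ideal.span_singleton_le_iff_mem,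
    mem_zeroLocus_iff_le_ker, hq]
  exact ⟨hΔ.2 q, hΔ.1.trans⟩

end Fibration

end AlexanderFibration

theorem mainTheorem5 (K : AlexanderFibration.Knot) (x : K.complement)
    (h : Abelianization (K.group x) ≃* Multiplicative ℤ)
    (P : AlexanderFibration.FinPresentation (K.group x)) :
    -- the fibre over a point of the `k`-th stratum
    (∀ k < P.n, ∀ t : ℂˣ,
      t ∈ AlexanderFibration.zeroLocus (AlexanderFibration.elementaryIdeal h P k) \
          AlexanderFibration.zeroLocus (AlexanderFibration.elementaryIdeal h P (k + 1)) →
        Nonempty (AlexanderFibration.Fibre h t ≃ₗ[ℂ] (Fin (k + 1) → ℂ))) ∧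
    -- the Alexander stratification
    (AlexanderFibration.zeroLocus (AlexanderFibration.elementaryIdeal h P 0) = Set.univ ∧
      AlexanderFibration.zeroLocus (AlexanderFibration.elementaryIdeal h P P.n) = ∅ ∧
      Antitone (fun k => AlexanderFibration.zeroLocus (AlexanderFibration.elementaryIdeal h P k)) ∧
      ∀ t : ℂˣ, ∃! k : ℕ, k < P.n ∧
        t ∈ AlexanderFibration.zeroLocus (AlexanderFibration.elementaryIdeal h P k) \
          AlexanderFibration.zeroLocus (AlexanderFibration.elementaryIdeal h P (k + 1))) ∧
    -- its closed pieces are the zero loci of the Alexander polynomials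
    (∀ (k : ℕ) (Δ : LaurentPolynomial ℤ), AlexanderFibration.IsAlexanderPolynomial h P k Δ →
      AlexanderFibration.zeroLocus (AlexanderFibration.elementaryIdeal h P k) =
        {t : ℂˣ | AlexanderFibration.evalAt t Δ = 0}) := by
  open AlexanderFibration in
  refine ⟨fun k _ t ht => ?_, ⟨?_, ?_, fun k l hkl t ht => ?_, fun t => ?_⟩,
    fun k Δ hΔ => zeroLocus_elementaryIdeal_eq h P hΔ⟩
  · rw [mem_stratum_iff] at ht
    have := finite_fibre h t P
    have hr := rank_add_finrank_fibre h P t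
    exact ⟨LinearEquiv.ofFinrankEq _ _ (by rw [Module.finrank_fin_fun]; omega)⟩
  · ext t
    simpa [mem_zeroLocus_elementaryIdeal_iff] using rank_alexanderMatrixAt_lt h P t
  · ext t
    simp [mem_zeroLocus_elementaryIdeal_iff]
  · rw [mem_zeroLocus_elementaryIdeal_iff] at ht ⊢
    omega
  · simp only [mem_stratum_iff]
    have hlt := rank_alexanderMatrixAt_lt h P t
    -- The index is the fibre dimension minus one; `hlt` keeps the natural subtraction from
    -- truncating.
    exact ⟨P.n - 1 - (alexanderMatrixAt h P t).rank, by omega, fun l ⟨_, hl⟩ => by omega⟩
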